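/- Let $K$ be a field with an involution $*$ (possibly the identity) and let $E=(E^0,E^1,\mathbf{s},\mathbf{r})$ be an arbitrary directed graph. Rings are associative but not necessarily unital. Let $L_K(E)$ be the Leavitt path algebra, i.e. the (not necessarily unital) $K$-algebra generated by $E^0\cup E^1\cup\{e^*: e\in E^1\}$ subject to the relations, for all vertices $v,w$ and edges $e,f$: (V) $vw=\delta_{v,w}v$; (E1) $\mathbf{s}(e)e=e\,\mathbf{r}(e)=e$; (E2) $\mathbf{r}(e)e^*=e^*\mathbf{s}(e)=e^*$; (CK1) $e^*f=\delta_{e,f}\mathbf{r}(e)$; (CK2) $v=\sum_{e\in\mathbf{s}^{-1}(v)}ee^*$ whenever $\mathbf{s}^{-1}(v)$ is finite and nonempty. Equip $L_K(E)$ with the involution determined by $v^*=v$, $(e)^*=e^*$ and $(ax)^*=a^*x^*$ for $a\in K$. A path $p$ is a vertex (with $\mathbf{r}(p)=p$) or a finite sequence $e_1\cdots e_n$ of edges with $\mathbf{r}(e_i)=\mathbf{s}(e_{i+1})$ (with $\mathbf{r}(p)=\mathbf{r}(e_n)$), regarded as an element of $L_K(E)$. An element of an involutive ring is called positive, written $x\ge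 0$, if it is a finite sum of elements of the form $yy^*$. Let $R$ be an involutive $K$-algebra, i.e. a (not necessarily unital) $K$-algebra with an involution such that $(ax)^*=a^*x^*$ for $a\in K$, $x\in R$, and let $t:L_K(E)\to R$ be a canonical, $K$-linear trace, that is, a $K$-linear map with $t(xy)=t(yx)$ for all $x,y\in L_K(E)$ and $t(pq^*)=\delta_{p,q}\,t(\mathbf{r}(p))$ for all paths $p,q$. Theorem. The trace $t$ is positive (that is, $t(x)\ge 0$ for every $x\in L_K(E)$ with $x\ge 0$) if and only if (P) $\quad t\bigl(v-\sum_{e\in I}\mathbf{r}(e)\bigr)\ge 0$ for every vertex $v$ and every finite subset $I$ of $\mathbf{s}^{-1}(v)$. -/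

import Mathlib

namespace LPA

/-- A directed graph with vertex set `V`, edge set `E`, source map `s` and range map `r`.
Loops and parallel edges are allowed, and `V`, `E` are arbitrary sets. -/
structure DirectedGraph (V : Type*) (E : Type*) where
  s : E → V
  r : E → V

namespace DirectedGraph

variable {V E : Type*}

/-- A vertex is regular if it emits at least one and only finitely many edges. -/
def IsRegular (G : DirectedGraph V E) (v : V) : Prop :=
  {e | G.s e = v}.Nonempty ∧ {e | G.s e = v}.Finite

/-- The list of edges is composable, and starts at `v` (the empty list starts anywhere). -/
def IsChainFrom (G : DirectedGraph V E) : V → List E → Prop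
  | _, [] => True
  | v, e :: l => G.s e = v ∧ G.IsChainFrom (G.r e) l

/-- The range of the path with source `v` and the given list of edges. -/
def endOf (G : DirectedGraph V E) : V → List E → V
  | v, [] => v
  | _, e :: l => G.endOf (G.r e) l

/-- Paths of a directed graph. Those with an empty list of edges are the vertices; for the
others the source is determined by the list of edges. -/
@[ext]
structure Path (G : DirectedGraph V E) where
  source : V
  edges : List E
  isChain : G.IsChainFrom source edges

/-- The range of a path. -/
def Path.range {G : DirectedGraph V E} (p : G.Path) : V := G.endOf p.source p.edges

end DirectedGraph

/-- Formal expressions in the generators `v`, `e`, `e*`. The Leavitt path algebra is a quotient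
of this type. -/
inductive Pre (K V E : Type*)
  | vertex (v : V)
  | edge (e : E)
  | ghost (e : E)
  | zero
  | add (a b : Pre K V E)
  | mul (a b : Pre K V E)
  | smul (k : K) (a : Pre K V E)

namespace Pre

variable {K V E : Type*}

/-- The formal sum of a list of expressions. -/
def sum : List (Pre K V E) → Pre K V E
  | [] => zero
  | a :: l => add a (sum l)

/-- The conjugate-linear, anti-multiplicative operation fixing the vertices and exchanging
`e` with `e*`. -/
def conj [Star K] : Pre K V E → Pre K V E
  | vertex v => vertex v
  | edge e => ghost e
  | ghost e => edge e
  | zero => zero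
  | add a b => add (conj a) (conj b)
  | mul a b => mul (conj b) (conj a)
  | smul k a => smul (star k) (conj a)

end Pre

open Pre in
/-- The relations imposed on formal expressions: the axioms of an associative, not necessarily
unital `K`-algebra, the relations (V), (E1), (E2), (CK1), (CK2), and compatibility with the
operations. -/
inductive Rel (K : Type*) [Field K] {V E : Type*} (G : DirectedGraph V E) :
    Pre K V E → Pre K V E → Prop
  -- the axioms of a `K`-algebra
  | add_assoc (a b c) : Rel K G (add (add a b) c) (add a (add b c))
  | add_comm (a b) : Rel K G (add a b) (add b a)
  | zero_add (a) : Rel K G (add zero a) a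
  | smul_add (k : K) (a b) : Rel K G (smul k (add a b)) (add (smul k a) (smul k b))
  | add_smul (k l : K) (a) : Rel K G (smul (k + l) a) (add (smul k a) (smul l a))
  | mul_smul (k l : K) (a) : Rel K G (smul (k * l) a) (smul k (smul l a))
  | one_smul (a) : Rel K G (smul 1 a) a
  | zero_smul (a) : Rel K G (smul 0 a) zero
  | mul_assoc (a b c) : Rel K G (mul (mul a b) c) (mul a (mul b c))
  | mul_add (a b c) : Rel K G (mul a (add b c)) (add (mul a b) (mul a c))
  | add_mul (a b c) : Rel K G (mul (add a b) c) (add (mul a c) (mul b c))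
  | smul_mul (k : K) (a b) : Rel K G (mul (smul k a) b) (smul k (mul a b))
  | mul_smul_comm (k : K) (a b) : Rel K G (mul a (smul k b)) (smul k (mul a b))
  -- compatibility with the operations
  | congr_add_right (a b c) (h : Rel K G a b) : Rel K G (add a c) (add b c)
  | congr_add_left (a b c) (h : Rel K G a b) : Rel K G (add c a) (add c b)
  | congr_mul_right (a b c) (h : Rel K G a b) : Rel K G (mul a c) (mul b c)
  | congr_mul_left (a b c) (h : Rel K G a b) : Rel K G (mul c a) (mul c b)
  | congr_smul (k : K) (a b) (h : Rel K G a b) : Rel K G (smul k a) (smul k b)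
  -- (V)
  | vertex_self (v : V) : Rel K G (mul (vertex v) (vertex v)) (vertex v)
  | vertex_ne (v w : V) (h : v ≠ w) : Rel K G (mul (vertex v) (vertex w)) zero
  -- (E1)
  | source_edge (e : E) : Rel K G (mul (vertex (G.s e)) (edge e)) (edge e)
  | edge_range (e : E) : Rel K G (mul (edge e) (vertex (G.r e))) (edge e)
  -- (E2)
  | range_ghost (e : E) : Rel K G (mul (vertex (G.r e)) (ghost e)) (ghost e)
  | ghost_source (e : E) : Rel K G (mul (ghost e) (vertex (G.s e))) (ghost e)
  -- (CK1)
  | ck1_self (e : E) : Rel K G (mul (ghost e) (edge e)) (vertex (G.r e))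
  | ck1_ne (e f : E) (h : e ≠ f) : Rel K G (mul (ghost e) (edge f)) zero
  -- (CK2)
  | ck2 (v : V) (h : G.IsRegular v) :
      Rel K G (vertex v) (Pre.sum (h.2.toFinset.toList.map fun e => mul (edge e) (ghost e)))

/-- The Leavitt path algebra of the graph `G` over the field `K`. -/
def LeavittPathAlgebra (K : Type*) [Field K] {V E : Type*} (G : DirectedGraph V E) :=
  Quot (Rel K G)

namespace LeavittPathAlgebra

section Algebra

variable {K : Type*} [Field K] {V E : Type*} {G : DirectedGraph V E}

/-- The class of a formal expression. -/
def mk (a : Pre K V E) : LeavittPathAlgebra K G := Quot.mk _ a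

instance : Zero (LeavittPathAlgebra K G) := ⟨mk .zero⟩

instance : Add (LeavittPathAlgebra K G) :=
  ⟨Quot.map₂ .add (fun _ _ _ h => .congr_add_left _ _ _ h)
    (fun _ _ _ h => .congr_add_right _ _ _ h)⟩

instance : Mul (LeavittPathAlgebra K G) :=
  ⟨Quot.map₂ .mul (fun _ _ _ h => .congr_mul_left _ _ _ h)
    (fun _ _ _ h => .congr_mul_right _ _ _ h)⟩

instance : SMul K (LeavittPathAlgebra K G) :=
  ⟨fun k => Quot.map (.smul k) (fun _ _ h => .congr_smul _ _ _ h)⟩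

instance : Neg (LeavittPathAlgebra K G) := ⟨fun x => (-1 : K) • x⟩

theorem mk_add (a b : Pre K V E) : (mk (.add a b) : LeavittPathAlgebra K G) = mk a + mk b := rfl

theorem mk_mul (a b : Pre K V E) : (mk (.mul a b) : LeavittPathAlgebra K G) = mk a * mk b := rfl

theorem mk_smul (k : K) (a : Pre K V E) :
    (mk (.smul k a) : LeavittPathAlgebra K G) = k • mk a := rfl

theorem mk_zero : (mk .zero : LeavittPathAlgebra K G) = 0 := rfl

theorem mk_eq {a b : Pre K V E} (h : Rel K G a b) : (mk a : LeavittPathAlgebra K G) = mk b :=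
  Quot.sound h

theorem add_comm_aux (x y : LeavittPathAlgebra K G) : x + y = y + x := by
  induction x using Quot.ind; induction y using Quot.ind
  exact mk_eq (.add_comm _ _)

theorem zero_add_aux (x : LeavittPathAlgebra K G) : 0 + x = x := by
  induction x using Quot.ind
  exact mk_eq (.zero_add _)

theorem zero_smul_aux (x : LeavittPathAlgebra K G) : (0 : K) • x = 0 := by
  induction x using Quot.ind
  exact mk_eq (.zero_smul _)

theorem one_smul_aux (x : LeavittPathAlgebra K G) : (1 : K) • x = x := by
  induction x using Quot.ind
  exact mk_eq (.one_smul _)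

theorem mul_smul_aux (k l : K) (x : LeavittPathAlgebra K G) :
    (k * l) • x = k • l • x := by
  induction x using Quot.ind
  exact mk_eq (.mul_smul _ _ _)

theorem add_smul_aux (k l : K) (x : LeavittPathAlgebra K G) :
    (k + l) • x = k • x + l • x := by
  induction x using Quot.ind
  exact mk_eq (.add_smul _ _ _)

theorem smul_mul_aux (k : K) (x y : LeavittPathAlgebra K G) :
    (k • x) * y = k • (x * y) := by
  induction x using Quot.ind; induction y using Quot.ind
  exact mk_eq (.smul_mul _ _ _)

theorem mul_smul_comm_aux (k : K) (x y : LeavittPathAlgebra K G) :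
    x * (k • y) = k • (x * y) := by
  induction x using Quot.ind; induction y using Quot.ind
  exact mk_eq (.mul_smul_comm _ _ _)

instance : NonUnitalRing (LeavittPathAlgebra K G) where
  add_assoc x y z := by
    induction x using Quot.ind; induction y using Quot.ind; induction z using Quot.ind
    exact mk_eq (.add_assoc _ _ _)
  zero_add := zero_add_aux
  add_zero x := by rw [add_comm_aux, zero_add_aux]
  add_comm := add_comm_aux
  nsmul := nsmulRec
  zsmul := zsmulRec
  neg_add_cancel x := by
    change (-1 : K) • x + x = 0
    nth_rewrite 2 [← one_smul_aux x]
    rw [← add_smul_aux, neg_add_cancel, zero_smul_aux]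
  left_distrib x y z := by
    induction x using Quot.ind; induction y using Quot.ind; induction z using Quot.ind
    exact mk_eq (.mul_add _ _ _)
  right_distrib x y z := by
    induction x using Quot.ind; induction y using Quot.ind; induction z using Quot.ind
    exact mk_eq (.add_mul _ _ _)
  zero_mul x := by
    rw [← zero_smul_aux 0, smul_mul_aux, zero_smul_aux, zero_smul_aux]
  mul_zero x := by
    rw [← zero_smul_aux 0, mul_smul_comm_aux, zero_smul_aux, zero_smul_aux]
  mul_assoc x y z := by
    induction x using Quot.ind; induction y using Quot.ind; induction z using Quot.ind
    exact mk_eq (.mul_assoc _ _ _)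

instance : Module K (LeavittPathAlgebra K G) where
  one_smul := one_smul_aux
  mul_smul := mul_smul_aux
  smul_zero k := by
    rw [← zero_smul_aux 0, ← mul_smul_aux, mul_zero]
  smul_add k x y := by
    induction x using Quot.ind; induction y using Quot.ind
    exact mk_eq (.smul_add _ _ _)
  add_smul := add_smul_aux
  zero_smul := zero_smul_aux

instance : IsScalarTower K (LeavittPathAlgebra K G) (LeavittPathAlgebra K G) :=
  ⟨smul_mul_aux⟩

instance : SMulCommClass K (LeavittPathAlgebra K G) (LeavittPathAlgebra K G) :=
  ⟨fun k x y => (mul_smul_comm_aux k x y).symm⟩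

variable (K G) in
/-- A vertex as an element of the algebra. -/
def vertex (v : V) : LeavittPathAlgebra K G := mk (.vertex v)

variable (K G) in
/-- An edge as an element of the algebra. -/
def edge (e : E) : LeavittPathAlgebra K G := mk (.edge e)

variable (K G) in
/-- The ghost edge `e*` as an element of the algebra. -/
def ghost (e : E) : LeavittPathAlgebra K G := mk (.ghost e)

theorem mk_sum_map {ι : Type*} (l : List ι) (f : ι → Pre K V E) :
    (mk (Pre.sum (l.map f)) : LeavittPathAlgebra K G) = (l.map fun i => mk (f i)).sum := by
  induction l with
  | nil => rfl
  | cons a l ih =>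
    rw [List.map_cons, List.map_cons, List.sum_cons, ← ih]
    rfl

theorem ck2 (v : V) (h : G.IsRegular v) :
    vertex K G v = ∑ e ∈ h.2.toFinset, edge K G e * ghost K G e := by
  rw [← Finset.sum_map_toList]
  exact (mk_eq (.ck2 v h)).trans (mk_sum_map _ _)

variable (K G) in
/-- The product `e₁ e₂ ⋯ eₙ r(eₙ)`, that is `e₁ e₂ ⋯ eₙ`, of a list of edges; for the empty list
it is the vertex `v`. -/
def ofList : V → List E → LeavittPathAlgebra K G
  | v, [] => vertex K G v
  | _, e :: l => edge K G e * ofList (G.r e) l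

variable (K) in
/-- A path as an element of the algebra. -/
def ofPath (p : G.Path) : LeavittPathAlgebra K G := ofList K G p.source p.edges

end Algebra

section Involution

variable {K : Type*} [Field K] [StarRing K] {V E : Type*} {G : DirectedGraph V E}

theorem mk_conj_sum (l : List E) :
    (mk (Pre.conj (Pre.sum (l.map fun e => .mul (.edge e) (.ghost e)))) :
      LeavittPathAlgebra K G) = mk (Pre.sum (l.map fun e => .mul (.edge e) (.ghost e))) := by
  induction l with
  | nil => rfl
  | cons a l ih =>
    simp only [List.map_cons, Pre.sum, Pre.conj, mk_add, ih]

theorem mk_conj_eq {a b : Pre K V E} (h : Rel K G a b) :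
    (mk a.conj : LeavittPathAlgebra K G) = mk b.conj := by
  induction h with
  | add_assoc a b c => exact mk_eq (.add_assoc _ _ _)
  | add_comm a b => exact mk_eq (.add_comm _ _)
  | zero_add a => exact mk_eq (.zero_add _)
  | smul_add k a b => exact mk_eq (.smul_add _ _ _)
  | add_smul k l a => simp only [Pre.conj, mk_add, mk_smul, star_add, _root_.add_smul]
  | mul_smul k l a =>
    simp only [Pre.conj, mk_smul, star_mul', SemigroupAction.mul_smul]
  | one_smul a => simp only [Pre.conj, mk_smul, star_one, _root_.one_smul]
  | zero_smul a => simp only [Pre.conj, mk_smul, star_zero, _root_.zero_smul, mk_zero]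
  | mul_assoc a b c => exact (mk_eq (.mul_assoc _ _ _)).symm
  | mul_add a b c => exact mk_eq (.add_mul _ _ _)
  | add_mul a b c => exact mk_eq (.mul_add _ _ _)
  | smul_mul k a b => exact mk_eq (.mul_smul_comm _ _ _)
  | mul_smul_comm k a b => exact mk_eq (.smul_mul _ _ _)
  | congr_add_right a b c h ih => simp only [Pre.conj, mk_add, ih]
  | congr_add_left a b c h ih => simp only [Pre.conj, mk_add, ih]
  | congr_mul_right a b c h ih => simp only [Pre.conj, mk_mul, ih]
  | congr_mul_left a b c h ih => simp only [Pre.conj, mk_mul, ih]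
  | congr_smul k a b h ih => simp only [Pre.conj, mk_smul, ih]
  | vertex_self v => exact mk_eq (.vertex_self v)
  | vertex_ne v w h => exact mk_eq (.vertex_ne _ _ h.symm)
  | source_edge e => exact mk_eq (.ghost_source e)
  | edge_range e => exact mk_eq (.range_ghost e)
  | range_ghost e => exact mk_eq (.edge_range e)
  | ghost_source e => exact mk_eq (.source_edge e)
  | ck1_self e => exact mk_eq (.ck1_self e)
  | ck1_ne e f h => exact mk_eq (.ck1_ne _ _ h.symm)
  | ck2 v h => exact (mk_eq (.ck2 v h)).trans (mk_conj_sum _).symm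

/-- The involution `(∑ aᵢ pᵢ qᵢ*)* = ∑ aᵢ* qᵢ pᵢ*` induced by the involution of the field. -/
instance : StarRing (LeavittPathAlgebra K G) where
  star := Quot.lift (fun a => mk a.conj) (fun _ _ h => mk_conj_eq h)
  star_involutive x := by
    induction x using Quot.ind with
    | mk a =>
      change mk a.conj.conj = mk a
      congr 1
      induction a with
      | add a b iha ihb => simp only [Pre.conj, iha, ihb]
      | mul a b iha ihb => simp only [Pre.conj, iha, ihb]
      | smul k a ih => simp only [Pre.conj, ih, star_star]
      | _ => rfl
  star_mul x y := by
    induction x using Quot.ind; induction y using Quot.ind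
    rfl
  star_add x y := by
    induction x using Quot.ind; induction y using Quot.ind
    rfl

instance : StarModule K (LeavittPathAlgebra K G) where
  star_smul k x := by
    induction x using Quot.ind
    rfl

theorem star_vertex (v : V) : star (vertex K G v) = vertex K G v := rfl

theorem star_edge (e : E) : star (edge K G e) = ghost K G e := rfl

end Involution

end LeavittPathAlgebra

/-- An element of a `*`-ring is positive if it is a finite sum of elements `y y*`. -/
def IsPositive {R : Type*} [NonUnitalRing R] [StarRing R] (x : R) : Prop :=
  ∃ (n : ℕ) (y : Fin n → R), x = ∑ i, y i * star (y i)

section Maps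

variable {A R : Type*}

/-- Central maps (an additive central map is a trace): `t (x y) = t (y x)`. -/
def IsCentral [Mul A] (t : A → R) : Prop := ∀ x y : A, t (x * y) = t (y * x)

/-- A map between `*`-rings is positive if it maps positive elements to positive elements. -/
def IsPositiveMap [NonUnitalRing A] [StarRing A] [NonUnitalRing R] [StarRing R]
    (t : A → R) : Prop :=
  ∀ x : A, IsPositive x → IsPositive (t x)

end Maps

section Canonical

variable {K : Type*} [Field K] [StarRing K] {V E : Type*} {G : DirectedGraph V E}
  {R : Type*} [NonUnitalRing R]

open LeavittPathAlgebra in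
open scoped Classical in
/-- A trace `t` is canonical if `t (p q*) = δ_{p,q} t (r(p))` for all paths `p` and `q`. -/
def IsCanonical (t : LeavittPathAlgebra K G → R) : Prop :=
  ∀ p q : G.Path, t (ofPath K p * star (ofPath K q)) =
    if p = q then t (vertex K G p.range) else 0

open LeavittPathAlgebra in
/-- Condition (P): `t (v - ∑_{e ∈ I} r(e)) ≥ 0` for all vertices `v` and all finite sets `I` of
edges with source `v`. -/
def ConditionP [StarRing R] (t : LeavittPathAlgebra K G → R) : Prop :=
  ∀ (v : V) (I : Finset E), (∀ e ∈ I, G.s e = v) →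
    IsPositive (t (vertex K G v - ∑ e ∈ I, vertex K G (G.r e)))

end Canonical

end LPA

/-! If `t` is positive, (P) follows by evaluating `t` at v - ∑ e e*, which is a projection x = x x*,
because t(e e*) = t(r(e)).

Conversely, centrality reduces the claim to t(y* y). Write y as a combination of monomials p q* with
r(p) = r(q), and order the pairs by (p, q) ≤ (p s, q s). This is a forest, where the children of (p,
q) are the pairs (p e, q e) with e starting at r(p). For monomials m, m' the canonical trace of m*
m' vanishes unless the pairs are comparable, and is then t of the range of the larger one. So t(y*
y) is a hermitian form on a finite down-closed set of pairs. Summation by parts (`sum_forest_eq`)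
rewrites it as ∑ b(v)* b(v) (τ(v) - ∑ τ(children of v)), where τ is t of the range and b(v) sums the
coefficients at pairs ≤ v. Each bracket is an instance of (P). Monomials need only span
(`span_range_monomial`); linear independence plays no role. -/

namespace LPA

/-! ### Hermitian forms on forests -/

open scoped Classical in
/-- A hermitian form on a finite down-closed subset `T` of a forest, whose value on two comparable
nodes depends on the larger one only and which vanishes on incomparable ones, is diagonal in the
partial sums of the coefficients. The relation `P v w` says that `v` is the parent of `w`. -/
theorem sum_forest_eq {N K M : Type*} [PartialOrder N] [Field K] [StarRing K] [AddCommGroup M]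
    [Module K M] (T : Finset N) (a : N → K) (τ : N → M) (B : N → N → M) (P : N → N → Prop)
    (hle : ∀ u w, u ≤ w → B u w = τ w) (hge : ∀ u w, w ≤ u → B u w = τ u)
    (hne : ∀ u w, ¬ u ≤ w → ¬ w ≤ u → B u w = 0)
    (hP : ∀ v w, P v w → ∀ u, u < w ↔ u ≤ v)
    (hT : ∀ w ∈ T, ∀ u, u < w → ∃ v ∈ T, P v w) :
    ∃ b : N → K, ∑ u ∈ T, ∑ w ∈ T, (star (a u) * a w) • B u w =
      ∑ v ∈ T, (star (b v) * b v) • (τ v - ∑ w ∈ T with P v w, τ w) := by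
  set b : N → K := fun w => ∑ u ∈ T with u ≤ w, a u with hb
  set c : N → K := fun w => ∑ u ∈ T with u < w, a u with hc
  have hbc : ∀ w ∈ T, b w = c w + a w := by
    intro w hw
    have : T.filter (· ≤ w) = insert w (T.filter (· < w)) := by
      ext u
      simp only [Finset.mem_filter, Finset.mem_insert, le_iff_lt_or_eq]
      constructor
      · rintro ⟨h, h' | h'⟩
        · exact .inr ⟨h, h'⟩
        · exact .inl h'
      · rintro (rfl | ⟨h, h'⟩)
        · exact ⟨hw, .inr rfl⟩
        · exact ⟨h, .inl h'⟩
    simp only [hb, hc, this]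
    rw [Finset.sum_insert (by simp), add_comm]
  -- The diagonal is counted by both halves, hence subtracted once.
  have hB : ∀ u w, B u w = (if u ≤ w then τ w else 0) + (if w ≤ u then τ u else 0) -
      (if u = w then τ w else 0) := by
    intro u w
    by_cases h₁ : u ≤ w <;> by_cases h₂ : w ≤ u
    · obtain rfl := le_antisymm h₁ h₂
      simp [hle u u le_rfl]
    · have : u ≠ w := fun h => h₂ h.ge
      simp [h₁, h₂, this, hle u w h₁]
    · have : u ≠ w := fun h => h₁ h.le
      simp [h₁, h₂, this, hge u w h₂]
    · have : u ≠ w := fun h => h₁ h.le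
      simp [h₁, h₂, this, hne u w h₁ h₂]
  -- The elements strictly below `w` are those below its unique parent, so `c w` is `b` at the
  -- parent; at a root both sides are 0.
  have hN : ∀ w ∈ T, ∑ v ∈ T with P v w, star (b v) * b v = star (c w) * c w := by
    intro w hw
    by_cases h : ∃ u, u < w
    · obtain ⟨u, hu⟩ := h
      obtain ⟨v, hv, hvw⟩ := hT w hw u hu
      have h₁ : T.filter (P · w) = {v} := by
        ext v'
        simp only [Finset.mem_filter, Finset.mem_singleton]
        constructor
        · rintro ⟨-, h'⟩
          exact le_antisymm ((hP v w hvw v').1 ((hP v' w h' v').2 le_rfl))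
            ((hP v' w h' v).1 ((hP v w hvw v).2 le_rfl))
        · rintro rfl
          exact ⟨hv, hvw⟩
      have h₂ : c w = b v := by
        simp only [hb, hc, hP v w hvw]
      rw [h₁, Finset.sum_singleton, h₂]
    · have h₁ : T.filter (P · w) = ∅ :=
        Finset.filter_eq_empty_iff.2 fun v _ hvw => h ⟨v, (hP v w hvw v).2 le_rfl⟩
      have h₂ : T.filter (· < w) = ∅ :=
        Finset.filter_eq_empty_iff.2 fun v _ hvw => h ⟨v, hvw⟩
      simp [hc, h₁, h₂]
  refine ⟨b, ?_⟩
  have key₁ : ∑ u ∈ T, ∑ w ∈ T, (star (a u) * a w) • (if u ≤ w then τ w else 0) =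
      ∑ w ∈ T, (star (b w) * a w) • τ w := by
    rw [Finset.sum_comm]
    refine Finset.sum_congr rfl fun w _ => ?_
    simp only [hb, star_sum, Finset.sum_mul, Finset.sum_smul, smul_ite, smul_zero,
      Finset.sum_filter]
    exact Finset.sum_congr rfl fun u _ => by split_ifs <;> simp
  have key₂ : ∑ u ∈ T, ∑ w ∈ T, (star (a u) * a w) • (if w ≤ u then τ u else 0) =
      ∑ u ∈ T, (star (a u) * b u) • τ u := by
    refine Finset.sum_congr rfl fun u _ => ?_
    simp only [hb, Finset.mul_sum, Finset.sum_smul, smul_ite, smul_zero, Finset.sum_filter]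
    exact Finset.sum_congr rfl fun w _ => by split_ifs <;> simp
  have key₃ : ∑ u ∈ T, ∑ w ∈ T, (star (a u) * a w) • (if u = w then τ w else 0) =
      ∑ u ∈ T, (star (a u) * a u) • τ u := by
    refine Finset.sum_congr rfl fun u hu => ?_
    simp [smul_ite, hu]
  -- Regroup by the child instead of the parent.
  have key₄ : ∑ v ∈ T, (star (b v) * b v) • ∑ w ∈ T with P v w, τ w =
      ∑ w ∈ T, (star (c w) * c w) • τ w := by
    simp only [Finset.smul_sum, Finset.sum_filter]
    rw [Finset.sum_comm]
    refine Finset.sum_congr rfl fun w hw => ?_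
    rw [← hN w hw, Finset.sum_smul, Finset.sum_filter]
    simp only [smul_ite, smul_zero]
  simp only [hB, smul_sub, smul_add, Finset.sum_sub_distrib, Finset.sum_add_distrib, key₁, key₂,
    key₃, key₄]
  rw [← Finset.sum_add_distrib, ← Finset.sum_sub_distrib, ← Finset.sum_sub_distrib]
  refine Finset.sum_congr rfl fun w hw => ?_
  -- Coefficient of `τ w`, with b = c + a: b* a + a* b - a* a = b* b - c* c.
  rw [← add_smul, ← sub_smul, ← sub_smul, hbc w hw, star_add]
  congr 1
  ring

/-! ### Closure properties of positive elements -/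

namespace IsPositive

variable {R : Type*} [NonUnitalRing R] [StarRing R]

theorem zero : IsPositive (0 : R) := ⟨0, fun i => i.elim0, by simp⟩

theorem mul_star_self (x : R) : IsPositive (x * star x) := ⟨1, fun _ => x, by simp⟩

theorem add {x y : R} (hx : IsPositive x) (hy : IsPositive y) : IsPositive (x + y) := by
  obtain ⟨n, f, rfl⟩ := hx
  obtain ⟨m, g, rfl⟩ := hy
  exact ⟨n + m, Fin.append f g, by simp [Fin.sum_univ_add]⟩

theorem sum {ι : Type*} (s : Finset ι) (f : ι → R) (h : ∀ i ∈ s, IsPositive (f i)) :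
    IsPositive (∑ i ∈ s, f i) :=
  Finset.sum_induction f IsPositive (fun _ _ => add) zero h

theorem star_mul_self_smul {K : Type*} [Field K] [StarRing K] [Module K R] [IsScalarTower K R R]
    [SMulCommClass K R R] [StarModule K R] (b : K) {x : R} (hx : IsPositive x) :
    IsPositive ((star b * b) • x) := by
  obtain ⟨n, f, rfl⟩ := hx
  refine ⟨n, fun i => b • f i, ?_⟩
  simp [Finset.smul_sum, smul_mul_assoc, mul_smul_comm, smul_smul]

end IsPositive

/-! ### Paths and the forest of path pairs -/

namespace DirectedGraph

variable {V E : Type*} {G : DirectedGraph V E}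

theorem endOf_append (v : V) (l m : List E) : G.endOf v (l ++ m) = G.endOf (G.endOf v l) m := by
  induction l generalizing v with
  | nil => rfl
  | cons e l ih => exact ih _

theorem isChainFrom_append (v : V) (l m : List E) :
    G.IsChainFrom v (l ++ m) ↔ G.IsChainFrom v l ∧ G.IsChainFrom (G.endOf v l) m := by
  induction l generalizing v with
  | nil => simp [IsChainFrom, endOf]
  | cons e l ih => simp [IsChainFrom, endOf, ih, and_assoc]

/-- A pair of paths with the same range. -/
@[ext]
structure PathPair (G : DirectedGraph V E) where
  left : G.Path
  right : G.Path
  range_eq : left.range = right.range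

namespace PathPair

/-- The pair `(p, q)` is below `(p s, q s)` for each path `s` that starts at the range. -/
instance : PartialOrder (PathPair G) where
  le u w := u.left.source = w.left.source ∧ u.right.source = w.right.source ∧
    ∃ s, w.left.edges = u.left.edges ++ s ∧ w.right.edges = u.right.edges ++ s
  le_refl u := ⟨rfl, rfl, [], by simp⟩
  le_trans := by
    rintro u v w ⟨h₁, h₂, s, h₃, h₄⟩ ⟨h₁', h₂', s', h₃', h₄'⟩
    exact ⟨h₁.trans h₁', h₂.trans h₂', s ++ s', by simp [h₃, h₃'], by simp [h₄, h₄']⟩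
  le_antisymm := by
    rintro u w ⟨h₁, h₂, s, h₃, h₄⟩ ⟨-, -, s', h₃', -⟩
    have : s = [] := by
      have := congrArg List.length h₃
      have := congrArg List.length h₃'
      simp only [List.length_append] at *
      exact List.length_eq_zero_iff.1 (by omega)
    subst this
    ext1 <;> ext1 <;> simp_all

/-- `IsChild e v w` says that `w = (p e, q e)` where `v = (p, q)`. -/
def IsChild (e : E) (v w : PathPair G) : Prop :=
  v.left.source = w.left.source ∧ v.right.source = w.right.source ∧
    w.left.edges = v.left.edges ++ [e] ∧ w.right.edges = v.right.edges ++ [e]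

theorem IsChild.source_eq {e : E} {v w : PathPair G} (h : IsChild e v w) :
    G.s e = v.left.range := by
  have := w.left.isChain
  rw [h.2.2.1, ← h.1, isChainFrom_append] at this
  exact this.2.1

theorem IsChild.range_eq {e : E} {v w : PathPair G} (h : IsChild e v w) :
    w.left.range = G.r e := by
  rw [Path.range, h.2.2.1, endOf_append]
  rfl

/-- Makes the passage from children of a pair to edges injective, so that a sum over children is a
sum over a set of edges as in (P). -/
theorem IsChild.right_unique {e : E} {v w w' : PathPair G} (h : IsChild e v w)
    (h' : IsChild e v w') : w = w' := by
  obtain ⟨h₁, h₂, h₃, h₄⟩ := h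
  obtain ⟨h₁', h₂', h₃', h₄'⟩ := h'
  ext1 <;> ext1
  exacts [h₁.symm.trans h₁', h₃.trans h₃'.symm, h₂.symm.trans h₂', h₄.trans h₄'.symm]

/-- A nonempty common suffix of `w` ends in `e`; deleting that last edge leaves a common suffix of
`v`. -/
theorem IsChild.lt_iff {e : E} {v w : PathPair G} (h : IsChild e v w) (u : PathPair G) :
    u < w ↔ u ≤ v := by
  obtain ⟨h₁, h₂, h₃, h₄⟩ := h
  constructor
  · intro hu
    obtain ⟨g₁, g₂, s, g₃, g₄⟩ := hu.le
    obtain rfl | ⟨s', f, rfl⟩ := List.eq_nil_or_concat' s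
    · refine absurd ?_ hu.ne
      ext1 <;> ext1 <;> simp_all
    · refine ⟨g₁.trans h₁.symm, g₂.trans h₂.symm, s', ?_, ?_⟩
      · rw [h₃, ← List.append_assoc] at g₃
        exact (List.append_inj' g₃ rfl).1
      · rw [h₄, ← List.append_assoc] at g₄
        exact (List.append_inj' g₄ rfl).1
  · intro hu
    refine lt_of_le_of_lt hu (lt_of_le_of_ne ⟨h₁, h₂, [e], h₃, h₄⟩ ?_)
    rintro rfl
    simp at h₃

/-- The parent drops the last edge of the nonempty common suffix. Being below `w`, it stays in every
down-closed set containing `w`. -/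
theorem exists_isChild_of_lt {u w : PathPair G} (h : u < w) : ∃ v ≤ w, ∃ e, IsChild e v w := by
  obtain ⟨g₁, g₂, s, g₃, g₄⟩ := h.le
  obtain rfl | ⟨s', e, rfl⟩ := List.eq_nil_or_concat' s
  · refine absurd ?_ h.ne
    ext1 <;> ext1 <;> simp_all
  · rw [← List.append_assoc] at g₃ g₄
    have hl := w.left.isChain
    have hr := w.right.isChain
    rw [g₃, isChainFrom_append] at hl
    rw [g₄, isChainFrom_append] at hr
    exact ⟨⟨⟨_, _, hl.1⟩, ⟨_, _, hr.1⟩, hl.2.1.symm.trans hr.2.1⟩, ⟨rfl, rfl, [e], g₃, g₄⟩,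
      e, rfl, rfl, g₃, g₄⟩

theorem finite_Iic (w : PathPair G) : (Set.Iic w).Finite := by
  -- A pair below `w` is determined by the length of its left path: this fixes the suffix removed
  -- from both sides.
  refine Set.Finite.of_finite_image (f := fun u : PathPair G => u.left.edges.length)
    ((Set.finite_Iic w.left.edges.length).subset ?_) ?_
  · rintro _ ⟨u, ⟨-, -, s, h, -⟩, rfl⟩
    simp [h]
  · rintro u ⟨h₁, h₂, s, h₃, h₄⟩ u' ⟨h₁', h₂', s', h₃', h₄'⟩ h
    obtain ⟨e₁, rfl⟩ := List.append_inj (h₃.symm.trans h₃') h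
    ext1 <;> ext1
    exacts [h₁.trans h₁'.symm, e₁, h₂.trans h₂'.symm, (List.append_inj' (h₄.symm.trans h₄') rfl).1]

end PathPair

end DirectedGraph

/-! ### Products of paths and the spanning monomials -/

namespace LeavittPathAlgebra

open DirectedGraph

section Algebra

variable {K : Type*} [Field K] {V E : Type*} {G : DirectedGraph V E}

theorem vertex_mul_self (v : V) : vertex K G v * vertex K G v = vertex K G v :=
  mk_eq (.vertex_self v)

theorem vertex_mul_of_ne {v w : V} (h : v ≠ w) : vertex K G v * vertex K G w = 0 :=
  mk_eq (.vertex_ne v w h)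

theorem vertex_mul_edge (e : E) : vertex K G (G.s e) * edge K G e = edge K G e :=
  mk_eq (.source_edge e)

theorem edge_mul_vertex (e : E) : edge K G e * vertex K G (G.r e) = edge K G e :=
  mk_eq (.edge_range e)

theorem vertex_mul_ghost (e : E) : vertex K G (G.r e) * ghost K G e = ghost K G e :=
  mk_eq (.range_ghost e)

theorem ghost_mul_vertex (e : E) : ghost K G e * vertex K G (G.s e) = ghost K G e :=
  mk_eq (.ghost_source e)

theorem ghost_mul_edge_self (e : E) : ghost K G e * edge K G e = vertex K G (G.r e) :=
  mk_eq (.ck1_self e)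

theorem ghost_mul_edge_of_ne {e f : E} (h : e ≠ f) : ghost K G e * edge K G f = 0 :=
  mk_eq (.ck1_ne e f h)

theorem vertex_mul_ofList {v : V} {l : List E} (h : G.IsChainFrom v l) :
    vertex K G v * ofList K G v l = ofList K G v l := by
  cases l with
  | nil => exact vertex_mul_self v
  | cons e l =>
    obtain ⟨rfl, -⟩ := h
    rw [ofList, ← mul_assoc, vertex_mul_edge]

theorem ofList_append {v : V} {l m : List E} (h : G.IsChainFrom v (l ++ m)) :
    ofList K G v (l ++ m) = ofList K G v l * ofList K G (G.endOf v l) m := by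
  induction l generalizing v with
  | nil => exact (vertex_mul_ofList h).symm
  | cons e l ih =>
    rw [List.cons_append, ofList, ofList, ih h.2, mul_assoc]
    rfl

/-- The path `p s`. -/
def _root_.LPA.DirectedGraph.Path.append (p : G.Path) (s : List E)
    (h : G.IsChainFrom p.range s) : G.Path :=
  ⟨p.source, p.edges ++ s, (isChainFrom_append _ _ _).2 ⟨p.isChain, h⟩⟩

theorem ofPath_append (p : G.Path) (s : List E) (h : G.IsChainFrom p.range s) :
    ofPath K (p.append s h) = ofPath K p * ofList K G p.range s :=
  ofList_append (p.append s h).isChain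

theorem range_append (p : G.Path) (s : List E) (h : G.IsChainFrom p.range s) :
    (p.append s h).range = G.endOf p.range s :=
  endOf_append _ _ _

end Algebra

section Involution

variable {K : Type*} [Field K] [StarRing K] {V E : Type*} {G : DirectedGraph V E}

theorem star_ofList_mul_ofList_append {v : V} {l m : List E} (h : G.IsChainFrom v (l ++ m)) :
    star (ofList K G v l) * ofList K G v (l ++ m) = ofList K G (G.endOf v l) m := by
  induction l generalizing v with
  | nil => exact vertex_mul_ofList h
  | cons e l ih =>
    rw [List.cons_append, ofList, ofList, star_mul, star_edge, mul_assoc, ← mul_assoc (ghost K G e),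
      ghost_mul_edge_self, vertex_mul_ofList (l := l ++ m) h.2, ih h.2]
    rfl

theorem star_ofList_append_mul_ofList {v : V} {l m : List E} (h : G.IsChainFrom v (l ++ m)) :
    star (ofList K G v (l ++ m)) * ofList K G v l = star (ofList K G (G.endOf v l) m) := by
  rw [← star_ofList_mul_ofList_append h, star_mul, star_star]

theorem star_ofList_mul_vertex {v : V} {l : List E} (h : G.IsChainFrom v l) :
    star (ofList K G v l) * vertex K G v = star (ofList K G v l) := by
  rw [← star_vertex (K := K) v, ← star_mul, vertex_mul_ofList h]

theorem star_ofList_mul_ofList_of_source_ne {v w : V} {l m : List E} (hl : G.IsChainFrom v l)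
    (hm : G.IsChainFrom w m) (h : v ≠ w) : star (ofList K G v l) * ofList K G w m = 0 := by
  rw [← star_ofList_mul_vertex hl, ← vertex_mul_ofList hm, mul_assoc, ← mul_assoc (vertex K G v),
    vertex_mul_of_ne h, zero_mul, mul_zero]

theorem star_ofList_mul_ofList_of_not_prefix {v : V} {l m : List E} (hl : G.IsChainFrom v l)
    (hm : G.IsChainFrom v m) (h₁ : ¬ l <+: m) (h₂ : ¬ m <+: l) :
    star (ofList K G v l) * ofList K G v m = 0 := by
  induction l generalizing v m with
  | nil => exact absurd List.nil_prefix h₁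
  | cons e l ih =>
    cases m with
    | nil => exact absurd List.nil_prefix h₂
    | cons f m =>
      rw [ofList, ofList, star_mul, star_edge, mul_assoc, ← mul_assoc (ghost K G e)]
      -- Equal first edges cancel by (CK1) and the tails are compared; distinct ones give 0.
      by_cases hef : e = f
      · subst hef
        rw [ghost_mul_edge_self, vertex_mul_ofList hm.2]
        exact ih hl.2 hm.2 (by simpa using h₁) (by simpa using h₂)
      · rw [ghost_mul_edge_of_ne hef, zero_mul, mul_zero]

/-- A product `p* q` of paths is a path, the adjoint of a path, or zero. -/
theorem star_ofPath_mul_ofPath_cases (p q : G.Path) :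
    (p.source = q.source ∧ ∃ s, q.edges = p.edges ++ s ∧ G.IsChainFrom p.range s ∧
      star (ofPath K p) * ofPath K q = ofList K G p.range s) ∨
    (p.source = q.source ∧ ∃ s, p.edges = q.edges ++ s ∧ G.IsChainFrom q.range s ∧
      star (ofPath K p) * ofPath K q = star (ofList K G q.range s)) ∨
    star (ofPath K p) * ofPath K q = 0 := by
  obtain ⟨v, l, hl⟩ := p
  obtain ⟨w, m, hm⟩ := q
  by_cases h : v = w
  · subst h
    by_cases h₁ : l <+: m
    · obtain ⟨s, rfl⟩ := h₁
      exact .inl ⟨rfl, s, rfl, ((isChainFrom_append _ _ _).1 hm).2,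
        star_ofList_mul_ofList_append hm⟩
    · by_cases h₂ : m <+: l
      · obtain ⟨s, rfl⟩ := h₂
        exact .inr (.inl ⟨rfl, s, rfl, ((isChainFrom_append _ _ _).1 hl).2,
          star_ofList_append_mul_ofList hl⟩)
      · exact .inr (.inr (star_ofList_mul_ofList_of_not_prefix hl hm h₁ h₂))
  · exact .inr (.inr (star_ofList_mul_ofList_of_source_ne hl hm h))

variable (K) in
/-- The monomial `p q*`. -/
def monomial (u : G.PathPair) : LeavittPathAlgebra K G := ofPath K u.left * star (ofPath K u.right)

/-- In (p q*)(p' q'*) the middle factor q* p' is a path s, some s*, or 0. It is absorbed as (p s)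
q'* or p (q' s)*, again a pair with equal ranges. -/
theorem monomial_mul_monomial_mem_span (u w : G.PathPair) :
    monomial K u * monomial K w ∈ Submodule.span K (Set.range (monomial K (G := G))) := by
  have e : monomial K u * monomial K w = ofPath K u.left *
      (star (ofPath K u.right) * ofPath K w.left) * star (ofPath K w.right) := by
    simp only [monomial, mul_assoc]
  rw [e]
  obtain ⟨h₀, s, hs, hc, h⟩ | ⟨h₀, s, hs, hc, h⟩ | h :=
    star_ofPath_mul_ofPath_cases (K := K) u.right w.left
  · have hc' := hc
    rw [← u.range_eq] at hc'
    rw [h, ← u.range_eq, ← ofPath_append _ _ hc']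
    refine Submodule.subset_span ⟨⟨u.left.append s hc', w.right, ?_⟩, rfl⟩
    rw [range_append, ← w.range_eq, u.range_eq, Path.range, Path.range, ← h₀, hs, endOf_append]
  · have hc' := hc
    rw [w.range_eq] at hc'
    rw [h, w.range_eq, mul_assoc, ← star_mul, ← ofPath_append _ _ hc']
    refine Submodule.subset_span ⟨⟨u.left, w.right.append s hc', ?_⟩, rfl⟩
    rw [range_append, u.range_eq, ← w.range_eq, Path.range, Path.range, h₀, hs, endOf_append]
  · rw [h, mul_zero, zero_mul]
    exact zero_mem _

theorem span_range_monomial : Submodule.span K (Set.range (monomial K (G := G))) = ⊤ := by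
  rw [eq_top_iff]
  rintro x -
  induction x using Quot.ind with
  | mk a =>
    induction a with
    | vertex v =>
      refine Submodule.subset_span ⟨⟨⟨v, [], trivial⟩, ⟨v, [], trivial⟩, rfl⟩, ?_⟩
      exact vertex_mul_self v
    | edge e =>
      refine Submodule.subset_span ⟨⟨⟨G.s e, [e], rfl, trivial⟩, ⟨G.r e, [], trivial⟩, rfl⟩, ?_⟩
      -- `ofList` ends every path with its range vertex, hence the extra factor.
      change edge K G e * vertex K G (G.r e) * vertex K G (G.r e) = edge K G e
      rw [edge_mul_vertex, edge_mul_vertex]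
    | ghost e =>
      refine Submodule.subset_span ⟨⟨⟨G.r e, [], trivial⟩, ⟨G.s e, [e], rfl, trivial⟩, rfl⟩, ?_⟩
      change vertex K G (G.r e) * (vertex K G (G.r e) * ghost K G e) = ghost K G e
      rw [vertex_mul_ghost, vertex_mul_ghost]
    | zero => exact zero_mem _
    | add a b iha ihb => exact add_mem iha ihb
    | smul k a ih => exact Submodule.smul_mem _ k ih
    | mul a b iha ihb =>
      refine Submodule.span_induction₂ (p := fun x y _ _ => x * y ∈ Submodule.span K _)
        ?_ ?_ ?_ ?_ ?_ ?_ ?_ iha ihb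
      · rintro _ _ ⟨u, rfl⟩ ⟨w, rfl⟩
        exact monomial_mul_monomial_mem_span u w
      · intro y _
        rw [zero_mul]; exact zero_mem _
      · intro y _
        rw [mul_zero]; exact zero_mem _
      · intro x y z _ _ _ hx hy
        rw [add_mul]; exact add_mem hx hy
      · intro x y z _ _ _ hx hy
        rw [mul_add]; exact add_mem hx hy
      · intro k x y _ _ h
        rw [smul_mul_assoc]; exact Submodule.smul_mem _ k h
      · intro k x y _ _ h
        rw [mul_smul_comm]; exact Submodule.smul_mem _ k h

end Involution

/-! ### The canonical trace on products of monomials -/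

section Trace

variable {K : Type*} [Field K] [StarRing K] {V E : Type*} {G : DirectedGraph V E}
  {R : Type*} [NonUnitalRing R]

theorem star_monomial_mul_monomial (u w : G.PathPair) :
    star (monomial K u) * monomial K w = ofPath K u.right *
      (star (ofPath K u.left) * ofPath K w.left) * star (ofPath K w.right) := by
  simp only [monomial, star_mul, star_star, mul_assoc]

/-- For u = (p, q) and w = (p s, q s): q p* (p s) (q s)* = (q s)(q s)*. -/
theorem star_monomial_mul_monomial_of_le {u w : G.PathPair} (h : u ≤ w) :
    star (monomial K u) * monomial K w = ofPath K w.right * star (ofPath K w.right) := by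
  obtain ⟨h₁, h₂, s, h₃, h₄⟩ := h
  have hl := w.left.isChain
  have hr := w.right.isChain
  rw [h₃, ← h₁] at hl
  rw [h₄, ← h₂] at hr
  have e₁ : star (ofPath K u.left) * ofPath K w.left = ofList K G u.right.range s := by
    rw [ofPath, ofPath, ← h₁, h₃, star_ofList_mul_ofList_append hl, ← u.range_eq]
    rfl
  have e₂ : ofPath K u.right * ofList K G u.right.range s = ofPath K w.right := by
    rw [ofPath, ofPath, ← h₂, h₄, ofList_append hr]
    rfl
  rw [star_monomial_mul_monomial, e₁, e₂]

variable {t : LeavittPathAlgebra K G → R}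

theorem _root_.LPA.IsCanonical.map_of_le (ht : IsCanonical t) {u w : G.PathPair} (h : u ≤ w) :
    t (star (monomial K u) * monomial K w) = t (vertex K G w.left.range) := by
  rw [star_monomial_mul_monomial_of_le h, ht, if_pos rfl, w.range_eq]

theorem _root_.LPA.IsCanonical.map_of_ge (ht : IsCanonical t) {u w : G.PathPair} (h : w ≤ u) :
    t (star (monomial K u) * monomial K w) = t (vertex K G u.left.range) := by
  rw [← star_star (monomial K w), ← star_mul, star_monomial_mul_monomial_of_le h, star_mul,
    star_star, ht, if_pos rfl, u.range_eq]

/-- If the left paths are comparable, say p' = p s, the product is (q s) q'*. Its trace is nonzero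
only if q s = q', which would make the pairs comparable. -/
theorem _root_.LPA.IsCanonical.map_of_incomparable (ht : IsCanonical t) (h0 : t 0 = 0)
    {u w : G.PathPair} (huw : ¬ u ≤ w) (hwu : ¬ w ≤ u) :
    t (star (monomial K u) * monomial K w) = 0 := by
  rw [star_monomial_mul_monomial]
  obtain ⟨h₀, s, hs, hc, h⟩ | ⟨h₀, s, hs, hc, h⟩ | h :=
    star_ofPath_mul_ofPath_cases (K := K) u.left w.left
  · have hc' := hc
    rw [u.range_eq] at hc'
    rw [h, u.range_eq, ← ofPath_append _ _ hc', ht, if_neg]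
    intro e
    obtain ⟨e₁, e₂⟩ := DirectedGraph.Path.ext_iff.1 e
    exact huw ⟨h₀, e₁, s, hs, e₂.symm⟩
  · have hc' := hc
    rw [w.range_eq] at hc'
    rw [h, w.range_eq, mul_assoc, ← star_mul, ← ofPath_append _ _ hc', ht, if_neg]
    intro e
    obtain ⟨e₁, e₂⟩ := DirectedGraph.Path.ext_iff.1 e
    exact hwu ⟨h₀.symm, e₁.symm, s, hs, e₂⟩
  · rw [h, mul_zero, zero_mul, h0]

theorem _root_.LPA.IsCanonical.map_edge_mul_ghost (ht : IsCanonical t) (e : E) :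
    t (edge K G e * ghost K G e) = t (vertex K G (G.r e)) := by
  have h := ht ⟨G.s e, [e], rfl, trivial⟩ ⟨G.s e, [e], rfl, trivial⟩
  rw [if_pos rfl] at h
  change t (edge K G e * vertex K G (G.r e) * star (edge K G e * vertex K G (G.r e))) = _ at h
  rw [edge_mul_vertex] at h
  exact h

end Trace

/-! ### The two implications -/

section Positivity

variable {K : Type*} [Field K] {V E : Type*} {G : DirectedGraph V E}
  {R : Type*} [NonUnitalRing R] [Module K R] [StarRing R]

/-- The element `v - ∑ e e*`, where `e` ranges over finitely many edges with source `v`, is a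
projection. -/
theorem vertex_sub_sum_mul_star_self [StarRing K] (v : V) (I : Finset E)
    (hI : ∀ e ∈ I, G.s e = v) :
    (vertex K G v - ∑ e ∈ I, edge K G e * ghost K G e) *
      star (vertex K G v - ∑ e ∈ I, edge K G e * ghost K G e) =
    vertex K G v - ∑ e ∈ I, edge K G e * ghost K G e := by
  classical
  set q := ∑ e ∈ I, edge K G e * ghost K G e with hq
  have hstar : star q = q := by
    simp [hq, star_sum, ← star_edge]
  have hv : vertex K G v * q = q := by
    rw [hq, Finset.mul_sum]
    refine Finset.sum_congr rfl fun e he => ?_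
    rw [← hI e he, ← mul_assoc, vertex_mul_edge]
  have hv' : q * vertex K G v = q := by
    rw [hq, Finset.sum_mul]
    refine Finset.sum_congr rfl fun e he => ?_
    rw [← hI e he, mul_assoc, ghost_mul_vertex]
  have hqq : q * q = q := by
    rw [hq, Finset.sum_mul]
    refine Finset.sum_congr rfl fun e he => ?_
    -- The elements e e* are orthogonal idempotents by (CK1).
    rw [Finset.mul_sum, Finset.sum_eq_single_of_mem e he]
    · rw [mul_assoc, ← mul_assoc (ghost K G e), ghost_mul_edge_self, vertex_mul_ghost]
    · intro f _ hf
      rw [mul_assoc, ← mul_assoc (ghost K G e), ghost_mul_edge_of_ne hf.symm, zero_mul, mul_zero]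
  rw [star_sub, star_vertex, hstar, sub_mul, mul_sub, mul_sub, vertex_mul_self, hv, hv', hqq]
  abel

theorem conditionP_of_isPositiveMap [StarRing K] {t : LeavittPathAlgebra K G →ₗ[K] R}
    (hc : IsCanonical t) (ht : IsPositiveMap t) : ConditionP t := by
  intro v I hI
  have h := ht _ (.mul_star_self (vertex K G v - ∑ e ∈ I, edge K G e * ghost K G e))
  rw [vertex_sub_sum_mul_star_self v I hI] at h
  simpa only [map_sub, map_sum, hc.map_edge_mul_ghost] using h

-- Condition (P) at the range of `v`, with I the set of last edges of the children of `v` lying in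
-- `T`.
open PathPair in
open scoped Classical in
theorem isPositive_sub_sum_children {t : LeavittPathAlgebra K G →ₗ[K] R} (hP : ConditionP t)
    (T : Finset G.PathPair) (v : G.PathPair) :
    IsPositive (t (vertex K G v.left.range) -
      ∑ w ∈ T with ∃ e, IsChild e v w, t (vertex K G w.left.range)) := by
  -- `choose!` needs a default edge; without edges there are no children and I = ∅ suffices.
  cases isEmpty_or_nonempty E
  · simpa using hP v.left.range ∅ (by simp)
  choose! f hf using fun (w : G.PathPair) (h : ∃ e, IsChild e v w) => h
  have hf' : ∀ w ∈ T.filter (fun w => ∃ e, IsChild e v w), IsChild (f w) v w := fun w hw =>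
    hf w (Finset.mem_filter.1 hw).2
  have h := hP v.left.range ((T.filter (fun w => ∃ e, IsChild e v w)).image f) ?_
  · rw [Finset.sum_image] at h
    · rw [map_sub, map_sum] at h
      convert h using 2
      refine Finset.sum_congr rfl fun w hw => ?_
      rw [(hf' w hw).range_eq]
    · intro w hw w' hw' e
      have h' := hf' w' hw'
      rw [← e] at h'
      exact (hf' w hw).right_unique h'
  · intro e he
    obtain ⟨w, hw, rfl⟩ := Finset.mem_image.1 he
    exact (hf' w hw).source_eq

open PathPair in
open scoped Classical in
theorem isPositive_map_star_mul_self [StarRing K] [IsScalarTower K R R]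
    [SMulCommClass K R R] [StarModule K R] {t : LeavittPathAlgebra K G →ₗ[K] R} (hc : IsCanonical t) (hP : ConditionP t)
    (y : LeavittPathAlgebra K G) : IsPositive (t (star y * y)) := by
  have hy : y ∈ Submodule.span K (Set.range (monomial K (G := G))) := by
    rw [span_range_monomial]; trivial
  obtain ⟨a, rfl⟩ := Finsupp.mem_span_range_iff_exists_finsupp.1 hy
  -- The down-closure of the support, so that `T` contains the parent of each of its non-root
  -- elements; the added coefficients are 0.
  set T : Finset G.PathPair := a.support.biUnion fun w => (finite_Iic w).toFinset with hTdef
  have hT : ∀ {u}, u ∈ T ↔ ∃ w ∈ a.support, u ≤ w := by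
    intro u
    simp [hTdef]
  have hsum : (a.sum fun i k => k • monomial K i) = ∑ w ∈ T, a w • monomial K w :=
    Finsupp.sum_of_support_subset _ (fun w hw => hT.2 ⟨w, hw, le_rfl⟩) _ (by simp)
  have hform : t (star (∑ w ∈ T, a w • monomial K w) * ∑ w ∈ T, a w • monomial K w) =
      ∑ u ∈ T, ∑ w ∈ T, (star (a u) * a w) • t (star (monomial K u) * monomial K w) := by
    simp only [star_sum, star_smul, Finset.sum_mul, Finset.mul_sum, smul_mul_assoc,
      mul_smul_comm, map_sum, map_smul, Finset.smul_sum]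
    rw [Finset.sum_comm]
    simp only [smul_smul, mul_comm]
  obtain ⟨b, hb⟩ := sum_forest_eq T a (fun w => t (vertex K G w.left.range))
    (fun u w => t (star (monomial K u) * monomial K w)) (fun v w => ∃ e, IsChild e v w)
    (fun _ _ => hc.map_of_le) (fun _ _ => hc.map_of_ge)
    (fun _ _ => hc.map_of_incomparable (map_zero t))
    (fun _ _ ⟨_, h⟩ u => h.lt_iff u) (fun w hw u hu => by
      obtain ⟨v, hv, h⟩ := exists_isChild_of_lt hu
      obtain ⟨z, hz, hwz⟩ := hT.1 hw
      exact ⟨v, hT.2 ⟨z, hz, hv.trans hwz⟩, h⟩)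
  rw [hsum, hform, hb]
  exact .sum _ _ fun v _ => (isPositive_sub_sum_children hP T v).star_mul_self_smul (b v)

end Positivity

end LeavittPathAlgebra

end LPA

theorem mainTheorem2 {K : Type*} [Field K] [StarRing K]
    {V E : Type*} (G : LPA.DirectedGraph V E)
    {R : Type*} [NonUnitalRing R] [Module K R] [IsScalarTower K R R] [SMulCommClass K R R]
    [StarRing R] [StarModule K R]
    (t : LPA.LeavittPathAlgebra K G →ₗ[K] R)
    (htrace : LPA.IsCentral t) (hcanonical : LPA.IsCanonical t) :
    LPA.IsPositiveMap t ↔ LPA.ConditionP t := by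
  refine ⟨LPA.LeavittPathAlgebra.conditionP_of_isPositiveMap hcanonical, fun hP x hx => ?_⟩
  obtain ⟨n, y, rfl⟩ := hx
  rw [map_sum]
  refine .sum _ _ fun i _ => ?_
  -- Centrality turns y y* into y* y, the form computed on monomials.
  rw [htrace]
  exact LPA.LeavittPathAlgebra.isPositive_map_star_mul_self hcanonical hP (y i)
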